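/- Let $\mathcal{C}$ be a small category and let $[\mathcal{C},\mathbf{Set}]$ be the topos of functors $\mathcal{C}\to\mathbf{Set}$; for a set $S$ write $\underline{S}$ for the constant functor with value $S$. Let $A$ be an object of $[\mathcal{C},\mathbf{Set}]$ equipped with arrows $+,\cdot:A\times A\to A$, ${}^{*}:A\to A$, $0:\underline{1}\to A$, a scalar multiplication $\underline{\mathbb{C}}\times A\to A$, and a subobject $N\subseteq A\times\underline{\mathbb{Q}^{+}}$, where $\mathbb{Q}^{+}$ is the set of positive rationals (read $(a,q)\in N$ as $\lVert a\rVert<q$). Call $A$ a *C\*-algebra in* $[\mathcal{C},\mathbf{Set}]$ if the following hold in the internal logic of the topos. 1. $A$ is an associative (not necessarily unital or commutative) algebra over $\underline{\mathbb{C}}$, and ${}^{*}$ is an anti-multiplicative, conjugate-linear involution. 2. $N$ is a submultiplicative norm with the C\*-property: $\exists q\,(a,q)\in N$; $(a,q)\in N\Leftrightarrow\exists p<q\,(a,p)\in N$; $(0,q)\in N$; $(a,p),(b,q)\in N\Rightarrow(a+b,p+q)\in N$ and $(ab,pq)\in N$; $|z|<p$ and $(a,q)\in N$ imply $(za,pq)\in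 N$; $(aa^{*},q^{2})\in N\Leftrightarrow(a,q)\in N$; and $(\forall q\,(a,q)\in N)\Rightarrow a=0$. 3. $A$ is complete: for all $f\in A^{\underline{\mathbb{N}}}$, if $(f(n)-f(m),2^{-n}+2^{-m})\in N$ for all $n,m$, then there is $a\in A$ with $(a-f(n),2\cdot 2^{-n})\in N$ for all $n$. Let $\mathbf{CStar}$ be the category of (not necessarily unital) complex C\*-algebras and $*$-homomorphisms in $\mathbf{Set}$. A functor $F:\mathcal{C}\to\mathbf{CStar}$ gives an object with such structure, denoted $\underline{F}$: its underlying functor is that of $F$, its operations are the pointwise ones, and $N(C)=\{(a,q)\mid\lVert a\rVert_{F(C)}<q\}$. Then: * An object $A$ with structure as above is a C\*-algebra in $[\mathcal{C},\mathbf{Set}]$ if and only if it is of the form $\underline{F}$ for some functor $F:\mathcal{C}\to\mathbf{CStar}$. Moreover, for functors $F,G:\mathcal{C}\to\mathbf{CStar}$, the natural transformations $F\to G$ correspond bijectively to the internal $*$-homomorphisms $\underline{F}\to\underline{G}$ (the arrows of $[\mathcal{C},\mathbf{Set}]$ that commute with $+,\cdot,{}^{*},0$ and scalar multiplication); so $F\mapsto\underline{F}$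 is an equivalence from $[\mathcal{C},\mathbf{CStar}]$ to the category of C\*-algebras in $[\mathcal{C},\mathbf{Set}]$ and internal $*$-homomorphisms. * $\underline{F}$ is commutative (internally, $xy=yx$) if and only if each $F(C)$ is commutative. * $\underline{F}$ is unital (there is an arrow $1:\underline{1}\to\underline{F}$ that is a two-sided unit for the multiplication) if and only if every $F(C)$ is unital and, for each $f:C\to D$ in $\mathcal{C}$, the $*$-homomorphism $F(f):F(C)\to F(D)$ preserves the unit. -/

import Mathlib

open CategoryTheory MonoidalCategory CartesianMonoidalCategory

universe u

noncomputable section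

/-! ### The category of C*-algebras in sets -/

/-- A C*-algebra in `Set` (complex, not necessarily unital, not necessarily commutative). -/
structure CStar : Type (u + 1) where
  /-- the underlying set -/
  carrier : Type u
  [str : NonUnitalCStarAlgebra carrier]

namespace CStar

instance : CoeSort CStar.{u} (Type u) := ⟨CStar.carrier⟩

attribute [instance] CStar.str

/-- C*-algebras and all (not necessarily unit-preserving) `*`-homomorphisms. -/
instance : Category CStar.{u} where
  Hom A B := A →⋆ₙₐ[ℂ] B
  id A := NonUnitalStarAlgHom.id ℂ A
  comp f g := NonUnitalStarAlgHom.comp g f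

/-- The `*`-homomorphism underlying a morphism of `CStar`. -/
def Hom.hom {A B : CStar.{u}} (f : A ⟶ B) : A →⋆ₙₐ[ℂ] B := f

/-- The underlying-set functor. -/
def forget : CStar.{u} ⥤ Type u where
  obj A := A
  map f := ↾(fun x => Hom.hom f x)

/-- `e` is a (two-sided) unit of the C*-algebra `A`. -/
def IsUnitElement (A : CStar.{u}) (e : A) : Prop := ∀ a : A, e * a = a ∧ a * e = a

end CStar

/-! ### Internal logic of the topos `[C, Set]`

Subobjects of `Γ` in `[C, Set]` are the subfunctors of `Γ`. A formula in context `Γ` is interpreted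
as a subobject of `Γ`; a term of type `X` in context `Γ` is a morphism `Γ ⟶ X`; a sequent
`φ ⊢ ψ` in context `Γ` holds iff `φ ≤ ψ` in the lattice of subobjects of `Γ`. -/

namespace PresheafTopos

variable {C : Type u} [SmallCategory C]

/-- Universal quantification over `X` of a formula in context `Γ × X`: the right adjoint of
pulling back subobjects along the projection `Γ × X ⟶ Γ`. -/
def all {Γ X : C ⥤ Type u} (φ : Subfunctor (Γ ⊗ X)) : Subfunctor Γ :=
  sSup {S | S.preimage (fst Γ X) ≤ φ}

/-- Existential quantification over `X` of a formula in context `Γ × X`: the image under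
the projection `Γ × X ⟶ Γ`, that is, the left adjoint of pulling back along it. -/
def ex {Γ X : C ⥤ Type u} (φ : Subfunctor (Γ ⊗ X)) : Subfunctor Γ :=
  φ.image (fst Γ X)

/-- `all` is right adjoint to weakening. -/
theorem le_all_iff {Γ X : C ⥤ Type u} (S : Subfunctor Γ) (φ : Subfunctor (Γ ⊗ X)) :
    S ≤ all φ ↔ S.preimage (fst Γ X) ≤ φ := by
  constructor
  · intro h c x hx
    have h' := h c hx
    simp only [all, Subfunctor.sSup_obj, Set.sSup_eq_sUnion, Set.mem_sUnion, Set.mem_image] at h'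
    obtain ⟨_, ⟨T, hT, rfl⟩, hxT⟩ := h'
    exact hT c hxT
  · intro h
    exact le_sSup h

/-- `ex` is left adjoint to weakening. -/
theorem ex_le_iff {Γ X : C ⥤ Type u} (φ : Subfunctor (Γ ⊗ X)) (S : Subfunctor Γ) :
    ex φ ≤ S ↔ φ ≤ S.preimage (fst Γ X) :=
  Subfunctor.image_le_iff _ _ _

/-- The formula `s = t` for two terms: the equalizer of `s` and `t`. -/
def eqn {Γ X : C ⥤ Type u} (s t : Γ ⟶ X) : Subfunctor Γ where
  obj c := {x | s.app c x = t.app c x}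
  map f x hx := by
    have hx' : s.app _ x = t.app _ x := hx
    change s.app _ (Γ.map f x) = t.app _ (Γ.map f x)
    rw [NatTrans.naturality_apply, NatTrans.naturality_apply, hx']

variable (C) in
/-- The constant object of `[C, Set]` on a set `S`. -/
abbrev Const (S : Type) : C ⥤ Type u := (Functor.const C).obj (ULift.{u} S)

/-- The constant term with value `s`. -/
def cst {S : Type} (s : S) {Γ : C ⥤ Type u} : Γ ⟶ Const C S where
  app _ := ↾(fun _ => ULift.up s)

/-- A unary function on sets, applied to a term of constant type. -/
def cmap {S S' : Type} (f : S → S') {Γ : C ⥤ Type u} (x : Γ ⟶ Const C S) :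
    Γ ⟶ Const C S' :=
  x ≫ (Functor.const C).map (↾(fun s : ULift.{u} S => ULift.up (f s.down)))

/-- The operation on constant objects induced by a binary function on sets. -/
def cop {S S' S'' : Type} (f : S → S' → S'') : Const C S ⊗ Const C S' ⟶ Const C S'' where
  app _ := ↾(fun p : ULift.{u} S × ULift.{u} S' => ULift.up (f p.1.down p.2.down))

/-- A binary function on sets, applied to two terms of constant type. -/
def cmap₂ {S S' S'' : Type} (f : S → S' → S'') {Γ : C ⥤ Type u}
    (x : Γ ⟶ Const C S) (y : Γ ⟶ Const C S') : Γ ⟶ Const C S'' :=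
  lift x y ≫ cop f

/-- The subobject of a product of constant objects given by a binary relation on sets. -/
def constRel {S S' : Type} (R : S → S' → Prop) : Subfunctor (Const C S ⊗ Const C S') where
  obj _ := {p : ULift.{u} S × ULift.{u} S' | R p.1.down p.2.down}
  map _ _ hp := hp

/-- The formula `R(x, y)` for terms `x`, `y` of constant type. -/
def rel {S S' : Type} (R : S → S' → Prop) {Γ : C ⥤ Type u}
    (x : Γ ⟶ Const C S) (y : Γ ⟶ Const C S') : Subfunctor Γ :=
  (constRel R).preimage (lift x y)

end PresheafTopos

open PresheafTopos

/-- The set of positive rational numbers. -/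
abbrev QPos : Type := {q : ℚ // 0 < q}

/-- The positive rational `2⁻ⁿ`. -/
def twoPowNeg (n : ℕ) : QPos := ⟨(2 ^ n)⁻¹, by positivity⟩

/-! ### C*-algebras in the topos `[C, Set]` -/

/-- An object of `[C, Set]` with arrows `+`, `·`, `*`, `0`, a scalar multiplication by the constant
object on `ℂ` and a subobject `N` of `A × ℚ⁺`; no axioms are imposed. The intended meaning
of `(a, q) ∈ N` is `‖a‖ < q`. -/
structure StarAlgData (C : Type u) [SmallCategory C] : Type (u + 1) where
  /-- the underlying object -/
  obj : C ⥤ Type u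
  /-- addition -/
  add : obj ⊗ obj ⟶ obj
  /-- multiplication -/
  mul : obj ⊗ obj ⟶ obj
  /-- involution -/
  star : obj ⟶ obj
  /-- zero -/
  zero : 𝟙_ (C ⥤ Type u) ⟶ obj
  /-- scalar multiplication -/
  smul : Const C ℂ ⊗ obj ⟶ obj
  /-- the norm -/
  N : Subfunctor (obj ⊗ Const C QPos)

namespace StarAlgData

variable {C : Type u} [SmallCategory C] (A : StarAlgData C) {Γ : C ⥤ Type u}

/-! Terms (generalized elements) `Γ ⟶ A.obj`. -/

/-- `x + y` -/
def plus (x y : Γ ⟶ A.obj) : Γ ⟶ A.obj := lift x y ≫ A.add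

/-- `x · y` -/
def times (x y : Γ ⟶ A.obj) : Γ ⟶ A.obj := lift x y ≫ A.mul

/-- `x*` -/
def adj (x : Γ ⟶ A.obj) : Γ ⟶ A.obj := x ≫ A.star

/-- `0` -/
def nil : Γ ⟶ A.obj := toUnit Γ ≫ A.zero

/-- `z x` for a scalar `z` -/
def act (z : Γ ⟶ Const C ℂ) (x : Γ ⟶ A.obj) : Γ ⟶ A.obj := lift z x ≫ A.smul

/-- `-x` -/
def neg (x : Γ ⟶ A.obj) : Γ ⟶ A.obj := A.act (cst (-1)) x

/-- `x - y` -/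
def minus (x y : Γ ⟶ A.obj) : Γ ⟶ A.obj := A.plus x (A.neg y)

/-- The formula `(x, q) ∈ N`. -/
def normLT (x : Γ ⟶ A.obj) (q : Γ ⟶ Const C QPos) : Subfunctor Γ :=
  A.N.preimage (lift x q)

/-- The object `A ^ ℕ` of sequences in `A` (an exponential in the topos). -/
abbrev Seq : C ⥤ Type u := (ihom (Const C ℕ)).obj A.obj

/-- The term `f(n)`. -/
def val (f : Γ ⟶ A.Seq) (n : Γ ⟶ Const C ℕ) : Γ ⟶ A.obj :=
  lift n f ≫ (ihom.ev (Const C ℕ)).app A.obj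

/-- The diagrams expressing that `A` is an associative `*`-algebra over `ℂ`. As usual, an equation
between composites of arrows is written for generalized elements `x y z : Γ ⟶ A.obj`. -/
structure IsStarAlgebra : Prop where
  add_assoc : ∀ {Γ : C ⥤ Type u} (x y z : Γ ⟶ A.obj),
    A.plus (A.plus x y) z = A.plus x (A.plus y z)
  add_comm : ∀ {Γ : C ⥤ Type u} (x y : Γ ⟶ A.obj), A.plus x y = A.plus y x
  zero_add : ∀ {Γ : C ⥤ Type u} (x : Γ ⟶ A.obj), A.plus A.nil x = x
  neg_add_cancel : ∀ {Γ : C ⥤ Type u} (x : Γ ⟶ A.obj), A.plus (A.neg x) x = A.nil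
  one_smul : ∀ {Γ : C ⥤ Type u} (x : Γ ⟶ A.obj), A.act (cst 1) x = x
  mul_smul : ∀ {Γ : C ⥤ Type u} (z w : Γ ⟶ Const C ℂ) (x : Γ ⟶ A.obj),
    A.act (cmap₂ (fun z w : ℂ => z * w) z w) x = A.act z (A.act w x)
  add_smul : ∀ {Γ : C ⥤ Type u} (z w : Γ ⟶ Const C ℂ) (x : Γ ⟶ A.obj),
    A.act (cmap₂ (fun z w : ℂ => z + w) z w) x = A.plus (A.act z x) (A.act w x)
  smul_add : ∀ {Γ : C ⥤ Type u} (z : Γ ⟶ Const C ℂ) (x y : Γ ⟶ A.obj),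
    A.act z (A.plus x y) = A.plus (A.act z x) (A.act z y)
  mul_assoc : ∀ {Γ : C ⥤ Type u} (x y z : Γ ⟶ A.obj),
    A.times (A.times x y) z = A.times x (A.times y z)
  mul_add : ∀ {Γ : C ⥤ Type u} (x y z : Γ ⟶ A.obj),
    A.times x (A.plus y z) = A.plus (A.times x y) (A.times x z)
  add_mul : ∀ {Γ : C ⥤ Type u} (x y z : Γ ⟶ A.obj),
    A.times (A.plus x y) z = A.plus (A.times x z) (A.times y z)
  smul_mul : ∀ {Γ : C ⥤ Type u} (z : Γ ⟶ Const C ℂ) (x y : Γ ⟶ A.obj),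
    A.times (A.act z x) y = A.act z (A.times x y)
  mul_smul_comm : ∀ {Γ : C ⥤ Type u} (z : Γ ⟶ Const C ℂ) (x y : Γ ⟶ A.obj),
    A.times x (A.act z y) = A.act z (A.times x y)
  star_star : ∀ {Γ : C ⥤ Type u} (x : Γ ⟶ A.obj), A.adj (A.adj x) = x
  star_mul : ∀ {Γ : C ⥤ Type u} (x y : Γ ⟶ A.obj),
    A.adj (A.times x y) = A.times (A.adj y) (A.adj x)
  star_add : ∀ {Γ : C ⥤ Type u} (x y : Γ ⟶ A.obj),
    A.adj (A.plus x y) = A.plus (A.adj x) (A.adj y)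
  star_smul : ∀ {Γ : C ⥤ Type u} (z : Γ ⟶ Const C ℂ) (x : Γ ⟶ A.obj),
    A.adj (A.act z x) = A.act (cmap (starRingEnd ℂ) z) (A.adj x)

/-- The axioms on `N` which say, in the internal logic, that `N` is a submultiplicative semi-norm
with the C*-property. -/
structure IsCStarSeminorm : Prop where
  /-- `⊢ ∃ q, (a, q) ∈ N` -/
  exists_normLT : (⊤ : Subfunctor A.obj) ≤ ex A.N
  /-- `(a, q) ∈ N ⊣⊢ ∃ p, p < q ∧ (a, p) ∈ N` in the context `(a, q)` -/
  rounded : A.N =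
    ex (Γ := A.obj ⊗ Const C QPos) (X := Const C QPos)
      (rel (fun p q : QPos => p < q) (snd _ _) (fst _ _ ≫ snd _ _) ⊓
        A.normLT (fst _ _ ≫ fst _ _) (snd _ _))
  /-- `⊢ (0, q) ∈ N` -/
  zero : ∀ {Γ : C ⥤ Type u} (q : Γ ⟶ Const C QPos), ⊤ ≤ A.normLT A.nil q
  /-- `(a, p) ∈ N ∧ (b, q) ∈ N ⊢ (a + b, p + q) ∈ N` -/
  add : ∀ {Γ : C ⥤ Type u} (a b : Γ ⟶ A.obj) (p q : Γ ⟶ Const C QPos),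
    A.normLT a p ⊓ A.normLT b q ≤
      A.normLT (A.plus a b) (cmap₂ (fun p q : QPos => p + q) p q)
  /-- `|z| < p ∧ (a, q) ∈ N ⊢ (z a, p q) ∈ N` -/
  smul : ∀ {Γ : C ⥤ Type u} (z : Γ ⟶ Const C ℂ) (a : Γ ⟶ A.obj)
    (p q : Γ ⟶ Const C QPos),
    rel (fun (z : ℂ) (p : QPos) => ‖z‖ < ((p : ℚ) : ℝ)) z p ⊓ A.normLT a q ≤
      A.normLT (A.act z a) (cmap₂ (fun p q : QPos => p * q) p q)
  /-- `(a, p) ∈ N ∧ (b, q) ∈ N ⊢ (a b, p q) ∈ N` -/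
  mul : ∀ {Γ : C ⥤ Type u} (a b : Γ ⟶ A.obj) (p q : Γ ⟶ Const C QPos),
    A.normLT a p ⊓ A.normLT b q ≤
      A.normLT (A.times a b) (cmap₂ (fun p q : QPos => p * q) p q)
  /-- `(a a*, q²) ∈ N ⊣⊢ (a, q) ∈ N` -/
  cstar : ∀ {Γ : C ⥤ Type u} (a : Γ ⟶ A.obj) (q : Γ ⟶ Const C QPos),
    A.normLT (A.times a (A.adj a)) (cmap (fun q : QPos => q * q) q) = A.normLT a q

/-- `∀ q, (a, q) ∈ N ⊢ a = 0`, in the context `a`. -/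
def IsNorm : Prop := all A.N ≤ eqn (𝟙 A.obj) A.nil

/-- The formula `∀ n, ∀ m, (f(n) - f(m), 2⁻ⁿ + 2⁻ᵐ) ∈ N` in the context `f : A ^ ℕ`. -/
def isCauchy : Subfunctor A.Seq :=
  all (X := Const C ℕ) (all (X := Const C ℕ)
    (let f := fst _ _ ≫ fst _ _
     let n := fst _ _ ≫ snd _ _
     let m := snd _ _
     A.normLT (A.minus (A.val f n) (A.val f m))
      (cmap₂ (fun n m : ℕ => twoPowNeg n + twoPowNeg m) n m)))

/-- The formula `∃ a, ∀ n, (a - f(n), 2 · 2⁻ⁿ) ∈ N` in the context `f : A ^ ℕ`. -/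
def hasLimit : Subfunctor A.Seq :=
  ex (X := A.obj) (all (X := Const C ℕ)
    (let f := fst _ _ ≫ fst _ _
     let a := fst _ _ ≫ snd _ _
     let n := snd _ _
     A.normLT (A.minus a (A.val f n)) (cmap (fun n : ℕ => twoPowNeg n + twoPowNeg n) n)))

/-- Internal completeness:
`∀ f ∈ A ^ ℕ, (∀ n m, ‖f(n) - f(m)‖ < 2⁻ⁿ + 2⁻ᵐ) ⇒ ∃ a, ∀ n, ‖a - f(n)‖ < 2 · 2⁻ⁿ`. -/
def IsComplete : Prop := A.isCauchy ≤ A.hasLimit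

/-- `A` is a C*-algebra in the topos `[C, Set]` (not necessarily unital or commutative). -/
structure IsCStarAlgebra : Prop where
  starAlgebra : A.IsStarAlgebra
  seminorm : A.IsCStarSeminorm
  norm : A.IsNorm
  complete : A.IsComplete

/-- Internal commutativity: `x · y = y · x`. -/
def IsCommutative : Prop :=
  ∀ {Γ : C ⥤ Type u} (x y : Γ ⟶ A.obj), A.times x y = A.times y x

/-- Internal unitality: there is an arrow `1 : 𝟙 ⟶ A` with `1 · x = x = x · 1`. -/
def IsUnital : Prop :=
  ∃ one : 𝟙_ (C ⥤ Type u) ⟶ A.obj, ∀ {Γ : C ⥤ Type u} (x : Γ ⟶ A.obj),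
    A.times (toUnit Γ ≫ one) x = x ∧ A.times x (toUnit Γ ≫ one) = x

/-- Internal `*`-homomorphisms: arrows of `[C, Set]` that commute with `+`, `·`, `*`, `0` and
scalar multiplication. -/
@[ext]
structure Hom (A B : StarAlgData C) where
  /-- the underlying arrow -/
  hom : A.obj ⟶ B.obj
  map_add : A.add ≫ hom = (hom ⊗ₘ hom) ≫ B.add
  map_mul : A.mul ≫ hom = (hom ⊗ₘ hom) ≫ B.mul
  map_star : A.star ≫ hom = hom ≫ B.star
  map_zero : A.zero ≫ hom = B.zero
  map_smul : A.smul ≫ hom = (Const C ℂ ◁ hom) ≫ B.smul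

instance : Category (StarAlgData C) where
  Hom := Hom
  id A := ⟨𝟙 A.obj, by simp, by simp, by simp, by simp, by simp⟩
  comp f g :=
    ⟨f.hom ≫ g.hom,
      by rw [← Category.assoc, f.map_add, Category.assoc, g.map_add]; simp,
      by rw [← Category.assoc, f.map_mul, Category.assoc, g.map_mul]; simp,
      by rw [← Category.assoc, f.map_star, Category.assoc, g.map_star]; simp,
      by rw [← Category.assoc, f.map_zero, g.map_zero],
      by rw [← Category.assoc, f.map_smul, Category.assoc, g.map_smul]; simp⟩
  id_comp f := Hom.ext (Category.id_comp f.hom)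
  comp_id f := Hom.ext (Category.comp_id f.hom)
  assoc f g h := Hom.ext (Category.assoc f.hom g.hom h.hom)

end StarAlgData

/-- The structure in `[C, Set]` given by a functor `F : C ⥤ CStar`: the underlying
object is `c ↦ F(c)`, the arrows are the pointwise operations, and
`N(c) = {(a, q) | ‖a‖ < q}` for the norm of `F(c)`. -/
def internalizeObj {C : Type u} [SmallCategory C] (F : C ⥤ CStar.{u}) : StarAlgData C where
  obj := F ⋙ CStar.forget
  add :=
    { app c := ↾(fun p : F.obj c × F.obj c => p.1 + p.2)
      naturality _ _ f := by
        ext p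
        have h (x y : F.obj _) := map_add (CStar.Hom.hom (F.map f)) x y
        exact (h p.1 p.2).symm }
  mul :=
    { app c := ↾(fun p : F.obj c × F.obj c => p.1 * p.2)
      naturality _ _ f := by
        ext p
        have h (x y : F.obj _) := map_mul (CStar.Hom.hom (F.map f)) x y
        exact (h p.1 p.2).symm }
  star :=
    { app c := ↾(fun a : F.obj c => Star.star (R := F.obj c) a)
      naturality _ _ f := by
        ext a
        have h (x : F.obj _) := map_star (CStar.Hom.hom (F.map f)) x
        exact (h a).symm }
  zero :=
    { app c := ↾(fun _ => (0 : F.obj c))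
      naturality _ _ f := by
        ext a
        exact (map_zero (CStar.Hom.hom (F.map f))).symm }
  smul :=
    { app c := ↾(fun p : ULift.{u} ℂ × F.obj c => p.1.down • p.2)
      naturality _ _ f := by
        ext p
        have h (z : ℂ) (x : F.obj _) := map_smul (CStar.Hom.hom (F.map f)) z x
        exact (h p.1.down p.2).symm }
  N :=
    { obj c := {p : F.obj c × ULift.{u} QPos | ‖p.1‖ < ((p.2.down : ℚ) : ℝ)}
      map f p hp := by
        have h (x : F.obj _) := NonUnitalStarAlgHom.norm_apply_le (CStar.Hom.hom (F.map f)) x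
        exact lt_of_le_of_lt (h p.1) hp }

/-- The assignment `internalizeObj`, as a functor from `[C, CStar]` to objects with
structure in `[C, Set]` and internal `*`-homomorphisms. -/
def internalize (C : Type u) [SmallCategory C] : (C ⥤ CStar.{u}) ⥤ StarAlgData C where
  obj F := internalizeObj F
  map {F G} α :=
    { hom := Functor.whiskerRight α CStar.forget
      map_add := by
        ext c p
        have h (x y : F.obj c) := map_add (CStar.Hom.hom (α.app c)) x y
        exact h p.1 p.2
      map_mul := by
        ext c p
        have h (x y : F.obj c) := map_mul (CStar.Hom.hom (α.app c)) x y
        exact h p.1 p.2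
      map_star := by
        ext c a
        have h (x : F.obj c) := map_star (CStar.Hom.hom (α.app c)) x
        exact h a
      map_zero := by
        ext c a
        exact map_zero (CStar.Hom.hom (α.app c))
      map_smul := by
        ext c p
        have h (z : ℂ) (x : F.obj c) := map_smul (CStar.Hom.hom (α.app c)) z x
        exact h p.1.down p.2 }
  map_id _ := rfl
  map_comp _ _ := rfl

end

noncomputable section

open PresheafTopos

/-! ### C*-norms from their open balls -/

/-! In `[C, Set]` products, images and equality are computed stage by stage, so an axiom built from
them holds internally iff it holds in every set `A(c)`. Universal quantifiers and the exponential `A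
^ ℕ` also refer to later stages `c ⟶ d`, but the formulas involved persist along arrows, because `N`
is a subfunctor and the operations are natural. Hence separatedness and completeness also reduce to
statements at a single stage (`mem_all_iff`, `isComplete_iff`).

An internal C*-algebra is therefore a family of *-algebras `A(c)`, each with a system of rational
open balls, and naturality of the operations says that the transition maps are *-homomorphisms. The
infimum of the radii turns the balls into a complete C*-norm, and roundedness guarantees that its
open balls are the given ones (`IsCStarBall.gauge_lt_iff`), so no part of the structure is lost.

In the other direction, *-homomorphisms of C*-algebras are contractive. This makes the pointwise
balls a subfunctor, and it is why morphisms need no norm condition: naturality and the algebraic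
identities already give full faithfulness. Commutativity is pointwise. A unit is a global element,
whose naturality is preservation of units because units are unique. -/

theorem exists_qPos_btwn {x y : ℝ} (hx : 0 ≤ x) (hxy : x < y) :
    ∃ q : QPos, x < ((q : ℚ) : ℝ) ∧ ((q : ℚ) : ℝ) < y := by
  obtain ⟨q, h1, h2⟩ := exists_rat_btwn hxy
  exact ⟨⟨q, by exact_mod_cast hx.trans_lt h1⟩, h1, h2⟩

theorem qPos_coe_mul (p q : QPos) :
    (((p * q : QPos) : ℚ) : ℝ) = ((p : ℚ) : ℝ) * ((q : ℚ) : ℝ) :=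
  Rat.cast_mul (p : ℚ) q

/-- The properties of a relation `N a q`, read `‖a‖ < q`, that make it the family of open balls
of a submultiplicative norm with the C*-property. -/
structure IsCStarBall {A : Type u} [NonUnitalRing A] [Module ℂ A] [Star A]
    (N : A → QPos → Prop) : Prop where
  exists_ball : ∀ a, ∃ q, N a q
  rounded : ∀ a q, N a q ↔ ∃ p, p < q ∧ N a p
  zero : ∀ q, N 0 q
  add : ∀ a b p q, N a p → N b q → N (a + b) (p + q)
  smul : ∀ (z : ℂ) a (p q : QPos), ‖z‖ < ((p : ℚ) : ℝ) → N a q → N (z • a) (p * q)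
  mul : ∀ a b p q, N a p → N b q → N (a * b) (p * q)
  cstar : ∀ a q, N (a * star a) (q * q) ↔ N a q
  separated : ∀ a, (∀ q, N a q) → a = 0

namespace IsCStarBall

/-- The infimum of the radii of the balls that contain `a`. -/
def gauge {A : Type u} (N : A → QPos → Prop) (a : A) : ℝ :=
  sInf {r : ℝ | ∃ q : QPos, N a q ∧ ((q : ℚ) : ℝ) = r}

theorem gauge_nonneg {A : Type u} (N : A → QPos → Prop) (a : A) : 0 ≤ gauge N a := by
  apply Real.sInf_nonneg
  rintro _ ⟨q, -, rfl⟩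
  exact_mod_cast q.2.le

variable {A : Type u} [NonUnitalRing A] [Module ℂ A] [StarRing A] {N : A → QPos → Prop}

theorem mono (h : IsCStarBall N) {a : A} {p q : QPos} (hpq : p ≤ q) (hp : N a p) : N a q := by
  obtain ⟨r, hr, hN⟩ := (h.rounded a p).1 hp
  exact (h.rounded a q).2 ⟨r, hr.trans_le hpq, hN⟩

/-- Roundedness makes the set of radii open from below, so its infimum is never attained.
Monotonicity in the radius gives the other direction. -/
theorem gauge_lt_iff (h : IsCStarBall N) (a : A) (q : QPos) :
    gauge N a < ((q : ℚ) : ℝ) ↔ N a q := by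
  have bdd : BddBelow {r : ℝ | ∃ q : QPos, N a q ∧ ((q : ℚ) : ℝ) = r} := by
    refine ⟨0, ?_⟩
    rintro _ ⟨q, -, rfl⟩
    exact_mod_cast q.2.le
  constructor
  · intro hq
    obtain ⟨q₀, hq₀⟩ := h.exists_ball a
    obtain ⟨_, ⟨p, hp, rfl⟩, hpq⟩ := exists_lt_of_csInf_lt
      (s := {r : ℝ | ∃ q : QPos, N a q ∧ ((q : ℚ) : ℝ) = r}) ⟨_, q₀, hq₀, rfl⟩ hq
    exact h.mono (Subtype.coe_le_coe.1 (by exact_mod_cast hpq.le)) hp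
  · intro hq
    obtain ⟨p, hpq, hp⟩ := (h.rounded a q).1 hq
    exact (csInf_le bdd ⟨p, hp, rfl⟩).trans_lt (by exact_mod_cast hpq)

/-- The passage from rational balls to real inequalities: the bounds for sums, products and scalar
multiples follow by approximating each factor from above by a rational. -/
theorem exists_ball_of_gauge_lt (h : IsCStarBall N) {a : A} {x : ℝ} (hx : gauge N a < x) :
    ∃ q : QPos, N a q ∧ ((q : ℚ) : ℝ) < x := by
  obtain ⟨q, h1, h2⟩ := exists_qPos_btwn (gauge_nonneg N a) hx
  exact ⟨q, (h.gauge_lt_iff a q).1 h1, h2⟩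

theorem gauge_add_le (h : IsCStarBall N) (a b : A) :
    gauge N (a + b) ≤ gauge N a + gauge N b := by
  refine le_add_of_forall_lt fun x hx y hy => ?_
  obtain ⟨p, hp, hpx⟩ := h.exists_ball_of_gauge_lt hx
  obtain ⟨q, hq, hqy⟩ := h.exists_ball_of_gauge_lt hy
  have := (h.gauge_lt_iff _ _).2 (h.add a b p q hp hq)
  push_cast at this
  linarith

theorem gauge_mul_le (h : IsCStarBall N) (a b : A) :
    gauge N (a * b) ≤ gauge N a * gauge N b := by
  refine le_mul_of_forall_lt₀ fun x hx y hy => ?_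
  obtain ⟨p, hp, hpx⟩ := h.exists_ball_of_gauge_lt hx
  obtain ⟨q, hq, hqy⟩ := h.exists_ball_of_gauge_lt hy
  have := (h.gauge_lt_iff _ _).2 (h.mul a b p q hp hq)
  rw [qPos_coe_mul] at this
  have hq0 : (0 : ℝ) ≤ ((q : ℚ) : ℝ) := by exact_mod_cast q.2.le
  exact this.le.trans
    (mul_le_mul hpx.le hqy.le hq0 ((gauge_nonneg N a).trans hx.le))

theorem gauge_smul_le (h : IsCStarBall N) (z : ℂ) (a : A) :
    gauge N (z • a) ≤ ‖z‖ * gauge N a := by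
  refine le_mul_of_forall_lt₀ fun x hx y hy => ?_
  obtain ⟨p, hp, hpx⟩ := exists_qPos_btwn (norm_nonneg z) hx
  obtain ⟨q, hq, hqy⟩ := h.exists_ball_of_gauge_lt hy
  have := (h.gauge_lt_iff _ _).2 (h.smul z a p q hp hq)
  rw [qPos_coe_mul] at this
  have hq0 : (0 : ℝ) ≤ ((q : ℚ) : ℝ) := by exact_mod_cast q.2.le
  exact this.le.trans
    (mul_le_mul hpx.le hqy.le hq0 ((norm_nonneg z).trans hx.le))

theorem gauge_zero (h : IsCStarBall N) : gauge N (0 : A) = 0 := by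
  refine le_antisymm (le_of_forall_gt fun x hx => ?_) (gauge_nonneg N 0)
  obtain ⟨q, -, h2⟩ := exists_qPos_btwn le_rfl hx
  exact ((h.gauge_lt_iff 0 q).2 (h.zero q)).trans h2

theorem gauge_neg (h : IsCStarBall N) (a : A) : gauge N (-a) = gauge N a := by
  have key (b : A) : gauge N (-b) ≤ gauge N b := by
    simpa using h.gauge_smul_le (-1) b
  exact le_antisymm (key a) (by simpa using key (-a))

/-- If it failed, a rational `q` would lie strictly between the square root of the gauge of `a *
star a` and the gauge of `a`; the ball form of the C*-property for `q * q` then contradicts the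
choice of `q`. -/
theorem gauge_mul_self_le (h : IsCStarBall N) (a : A) :
    gauge N a * gauge N a ≤ gauge N (a * star a) := by
  by_contra! hlt
  have h0 := gauge_nonneg N a
  have hs : √(gauge N (a * star a)) < gauge N a :=
    (Real.sqrt_lt' (by nlinarith [gauge_nonneg N (a * star a)])).2 (by rwa [sq])
  obtain ⟨q, h1, h2⟩ := exists_qPos_btwn (Real.sqrt_nonneg _) hs
  have hq0 : (0 : ℝ) < ((q : ℚ) : ℝ) := by exact_mod_cast q.2
  rw [Real.sqrt_lt' hq0, sq] at h1
  have h3 : N (a * star a) (q * q) := (h.gauge_lt_iff _ _).1 (by rwa [qPos_coe_mul])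
  exact lt_asymm h2 ((h.gauge_lt_iff _ _).2 ((h.cstar a q).1 h3))

/-- Cancel one factor in `‖a‖² ≤ ‖a a*‖ ≤ ‖a‖ ‖a*‖`; the case `‖a‖ = 0` is trivial. -/
theorem gauge_le_gauge_star (h : IsCStarBall N) (a : A) : gauge N a ≤ gauge N (star a) := by
  have h1 := (h.gauge_mul_self_le a).trans (h.gauge_mul_le a (star a))
  rcases (gauge_nonneg N a).eq_or_lt with h0 | h0
  · exact h0 ▸ gauge_nonneg N (star a)
  · exact le_of_mul_le_mul_left h1 h0

/-- The axiom on balls concerns `a * star a`, whereas `NonUnitalCStarAlgebra` asks for `star a * a`;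
comparing `a` with `star a` exchanges the two. -/
theorem gauge_mul_self_le' (h : IsCStarBall N) (a : A) :
    gauge N a * gauge N a ≤ gauge N (star a * a) := by
  have h1 := h.gauge_mul_self_le (star a)
  rw [star_star] at h1
  exact (mul_self_le_mul_self (gauge_nonneg N a) (h.gauge_le_gauge_star a)).trans h1

/-- The gauge of the balls as a ring norm. -/
def ringNorm (h : IsCStarBall N) : RingNorm A where
  toFun := gauge N
  map_zero' := h.gauge_zero
  add_le' := h.gauge_add_le
  neg' := h.gauge_neg
  mul_le' := h.gauge_mul_le
  eq_zero_of_map_eq_zero' a ha :=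
    h.separated a fun q => (h.gauge_lt_iff a q).1 (by
      change gauge N a = 0 at ha
      rw [ha]
      exact_mod_cast q.2)

/-- The normed ring whose open balls are given by `N`. -/
abbrev normedRing (h : IsCStarBall N) : NonUnitalNormedRing A where
  __ := ‹NonUnitalRing A›
  __ := h.ringNorm.toAddGroupNorm.toNormedAddCommGroup
  norm_mul_le := map_mul_le_mul h.ringNorm

theorem completeSpace (h : IsCStarBall N)
    (hc : ∀ f : ℕ → A, (∀ n m, N (f n - f m) (twoPowNeg n + twoPowNeg m)) →
      ∃ a, ∀ n, N (a - f n) (twoPowNeg n + twoPowNeg n)) :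
    let := h.normedRing
    CompleteSpace A := by
  let _ := h.normedRing
  have coe_twoPowNeg (n : ℕ) : (((twoPowNeg n : QPos) : ℚ) : ℝ) = (1 / 2) ^ n := by
    simp [twoPowNeg]
  refine Metric.complete_of_convergent_controlled_sequences (fun n => (1 / 2 : ℝ) ^ n)
    (fun n => by positivity) fun f hf => ?_
  obtain ⟨a, ha⟩ := hc f fun n m => by
    rw [← h.gauge_lt_iff]
    push_cast
    rw [coe_twoPowNeg, coe_twoPowNeg]
    change ‖f n - f m‖ < _
    rw [← dist_eq_norm]
    have hn : (0 : ℝ) < (1 / 2) ^ n := by positivity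
    have hm : (0 : ℝ) < (1 / 2) ^ m := by positivity
    -- The control at index `min n m` bounds the distance by the larger of the two powers, which is
    -- less than their sum.
    rcases le_total n m with hnm | hnm
    · linarith [hf n n m le_rfl hnm]
    · linarith [hf m n m hnm le_rfl]
  refine ⟨a, ?_⟩
  rw [tendsto_iff_dist_tendsto_zero]
  have lim : Filter.Tendsto (fun n : ℕ => (1 / 2 : ℝ) ^ n + (1 / 2) ^ n) Filter.atTop (nhds 0) := by
    have := tendsto_pow_atTop_nhds_zero_of_lt_one (r := (1 / 2 : ℝ)) (by norm_num) (by norm_num)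
    simpa using this.add this
  refine squeeze_zero (fun n => dist_nonneg) (fun n => ?_) lim
  have := (h.gauge_lt_iff _ _).2 (ha n)
  push_cast at this
  rw [coe_twoPowNeg] at this
  rw [dist_comm, dist_eq_norm]
  exact this.le

/-- The C*-algebra whose open balls are given by `N`. -/
abbrev cstarAlgebra [IsScalarTower ℂ A A] [SMulCommClass ℂ A A] [StarModule ℂ A]
    (h : IsCStarBall N)
    (hc : ∀ f : ℕ → A, (∀ n m, N (f n - f m) (twoPowNeg n + twoPowNeg m)) →
      ∃ a, ∀ n, N (a - f n) (twoPowNeg n + twoPowNeg n)) :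
    NonUnitalCStarAlgebra A where
  __ := h.normedRing
  __ := ‹StarRing A›
  __ := ‹Module ℂ A›
  complete := (h.completeSpace hc).complete
  norm_mul_self_le := h.gauge_mul_self_le'
  norm_smul_le := h.gauge_smul_le
  smul_assoc := smul_assoc
  smul_comm := smul_comm
  star_smul := star_smul

end IsCStarBall

/-! ### Internal C*-algebras, stage by stage -/

namespace PresheafTopos

variable {C : Type u} [SmallCategory C]

theorem app_congr {Γ X : C ⥤ Type u} {s t : Γ ⟶ X} (h : s = t) (c : C) (x : Γ.obj c) :
    s.app c x = t.app c x := by rw [h]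

theorem mem_of_le {Γ : C ⥤ Type u} {S T : Subfunctor Γ} (h : S ≤ T) (c : C) (x : Γ.obj c)
    (hx : x ∈ S.obj c) : x ∈ T.obj c :=
  h c hx

theorem mem_congr {Γ : C ⥤ Type u} {S T : Subfunctor Γ} (h : S = T) (c : C) (x : Γ.obj c) :
    x ∈ S.obj c ↔ x ∈ T.obj c := by rw [h]

theorem map_mem {Γ : C ⥤ Type u} (S : Subfunctor Γ) {c d : C} (f : c ⟶ d) (x : Γ.obj c)
    (hx : x ∈ S.obj c) : Γ.map f x ∈ S.obj d :=
  S.map f hx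

/-- The Kripke–Joyal clause for `∀`: the right-hand side is stable under restriction, so it defines
a subfunctor, and the adjunction places that subfunctor below `all φ`. -/
theorem mem_all_iff {Γ X : C ⥤ Type u} (φ : Subfunctor (Γ ⊗ X)) (c : C) (x : Γ.obj c) :
    x ∈ (all φ).obj c ↔
      ∀ (d : C) (f : c ⟶ d) (y : X.obj d), (Γ.map f x, y) ∈ φ.obj d := by
  constructor
  · intro hx d f y
    exact (le_all_iff _ φ).1 le_rfl d ((all φ).map f hx)
  · intro hx
    let S : Subfunctor Γ :=
      { obj c' := {x' | ∀ (d : C) (f : c' ⟶ d) (y : X.obj d), (Γ.map f x', y) ∈ φ.obj d}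
        map {c' d'} g x' hx' d f y := by
          have := hx' d (g ≫ f) y
          rwa [Functor.map_comp_apply] at this }
    have hS : S ≤ all φ := (le_all_iff S φ).2 fun d p hp => by
      have := hp d (𝟙 d) p.2
      rwa [Functor.map_id_apply] at this
    exact hS c hx

/-- Images are computed pointwise, so a witness exists at the same stage, with no passage to a
cover. -/
theorem mem_ex_iff {Γ X : C ⥤ Type u} (φ : Subfunctor (Γ ⊗ X)) (c : C) (x : Γ.obj c) :
    x ∈ (ex φ).obj c ↔ ∃ y : X.obj c, (x, y) ∈ φ.obj c := by
  constructor
  · rintro ⟨p, hp, rfl⟩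
    exact ⟨p.2, hp⟩
  · rintro ⟨y, hy⟩
    exact ⟨(x, y), hy, rfl⟩

end PresheafTopos

/-! ### Operations, balls and sequences at a stage -/

namespace StarAlgData

variable {C : Type u} [SmallCategory C] (A : StarAlgData C)

/-- Addition at stage `c`. -/
def addAt (c : C) (x y : A.obj.obj c) : A.obj.obj c := A.add.app c (x, y)

/-- Multiplication at stage `c`. -/
def mulAt (c : C) (x y : A.obj.obj c) : A.obj.obj c := A.mul.app c (x, y)

/-- Involution at stage `c`. -/
def starAt (c : C) (x : A.obj.obj c) : A.obj.obj c := A.star.app c x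

/-- Zero at stage `c`. -/
def zeroAt (c : C) : A.obj.obj c := A.zero.app c PUnit.unit

/-- Scalar multiplication at stage `c`. -/
def smulAt (c : C) (z : ℂ) (x : A.obj.obj c) : A.obj.obj c := A.smul.app c (ULift.up z, x)

/-- The formula `(a, q) ∈ N` at stage `c`. -/
def ballAt (c : C) (x : A.obj.obj c) (q : QPos) : Prop := (x, ULift.up q) ∈ A.N.obj c

variable {A}

namespace IsStarAlgebra

/-- The additive group at stage `c`. -/
abbrev addCommGroup (h : A.IsStarAlgebra) (c : C) : AddCommGroup (A.obj.obj c) :=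
  -- An identity of generalized elements is applied to the generic ones, the projections of a
  -- product, and evaluated at stage `c`. The other axioms are extracted in the same way.
  let add_comm' (x y : A.obj.obj c) : A.addAt c x y = A.addAt c y x :=
    app_congr (h.add_comm (fst A.obj A.obj) (snd A.obj A.obj)) c (x, y)
  let zero_add' (x : A.obj.obj c) : A.addAt c (A.zeroAt c) x = x :=
    app_congr (h.zero_add (𝟙 A.obj)) c x
  { add := A.addAt c
    zero := A.zeroAt c
    neg := A.smulAt c (-1)
    nsmul := @nsmulRec _ ⟨A.zeroAt c⟩ ⟨A.addAt c⟩
    zsmul := @zsmulRec _ ⟨A.zeroAt c⟩ ⟨A.addAt c⟩ ⟨A.smulAt c (-1)⟩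
      (@nsmulRec _ ⟨A.zeroAt c⟩ ⟨A.addAt c⟩)
    add_assoc x y z :=
      app_congr (h.add_assoc (fst A.obj (A.obj ⊗ A.obj)) (snd _ _ ≫ fst _ _) (snd _ _ ≫ snd _ _))
        c (x, y, z)
    add_comm := add_comm'
    zero_add := zero_add'
    add_zero x := (add_comm' x (A.zeroAt c)).trans (zero_add' x)
    neg_add_cancel x := app_congr (h.neg_add_cancel (𝟙 A.obj)) c x }

/-- The ring at stage `c`. -/
abbrev nonUnitalRing (h : A.IsStarAlgebra) (c : C) : NonUnitalRing (A.obj.obj c) :=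
  let _ := h.addCommGroup c
  let mul_add' (x y z : A.obj.obj c) :
      A.mulAt c x (y + z) = A.mulAt c x y + A.mulAt c x z :=
    app_congr (h.mul_add (fst A.obj (A.obj ⊗ A.obj)) (snd _ _ ≫ fst _ _) (snd _ _ ≫ snd _ _))
      c (x, y, z)
  let add_mul' (x y z : A.obj.obj c) :
      A.mulAt c (x + y) z = A.mulAt c x z + A.mulAt c y z :=
    app_congr (h.add_mul (fst A.obj (A.obj ⊗ A.obj)) (snd _ _ ≫ fst _ _) (snd _ _ ≫ snd _ _))
      c (x, y, z)
  { h.addCommGroup c with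
    mul := A.mulAt c
    mul_assoc x y z :=
      app_congr (h.mul_assoc (fst A.obj (A.obj ⊗ A.obj)) (snd _ _ ≫ fst _ _) (snd _ _ ≫ snd _ _))
        c (x, y, z)
    left_distrib := mul_add'
    right_distrib := add_mul'
    zero_mul x := by
      have := add_mul' 0 0 x
      rw [add_zero] at this
      exact left_eq_add.1 this
    mul_zero x := by
      have := mul_add' x 0 0
      rw [add_zero] at this
      exact left_eq_add.1 this }

/-- The involution at stage `c`. -/
abbrev starRing (h : A.IsStarAlgebra) (c : C) :
    let _ := h.nonUnitalRing c
    StarRing (A.obj.obj c) :=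
  let _ := h.nonUnitalRing c
  { star := A.starAt c
    star_involutive x := app_congr (h.star_star (𝟙 A.obj)) c x
    star_mul x y := app_congr (h.star_mul (fst A.obj A.obj) (snd A.obj A.obj)) c (x, y)
    star_add x y := app_congr (h.star_add (fst A.obj A.obj) (snd A.obj A.obj)) c (x, y) }

/-- The scalar multiplication at stage `c`. -/
abbrev module (h : A.IsStarAlgebra) (c : C) :
    let _ := h.nonUnitalRing c
    Module ℂ (A.obj.obj c) :=
  let _ := h.nonUnitalRing c
  let add_smul' (z w : ℂ) (x : A.obj.obj c) :
      A.smulAt c (z + w) x = A.smulAt c z x + A.smulAt c w x :=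
    app_congr (h.add_smul (fst (Const C ℂ) (Const C ℂ ⊗ A.obj))
      (snd _ _ ≫ fst _ _) (snd _ _ ≫ snd _ _)) c (ULift.up z, ULift.up w, x)
  let smul_add' (z : ℂ) (x y : A.obj.obj c) :
      A.smulAt c z (x + y) = A.smulAt c z x + A.smulAt c z y :=
    app_congr (h.smul_add (fst (Const C ℂ) (A.obj ⊗ A.obj))
      (snd _ _ ≫ fst _ _) (snd _ _ ≫ snd _ _)) c (ULift.up z, x, y)
  { smul := A.smulAt c
    one_smul x := app_congr (h.one_smul (𝟙 A.obj)) c x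
    mul_smul z w x :=
      app_congr (h.mul_smul (fst (Const C ℂ) (Const C ℂ ⊗ A.obj))
        (snd _ _ ≫ fst _ _) (snd _ _ ≫ snd _ _)) c (ULift.up z, ULift.up w, x)
    add_smul := add_smul'
    smul_add := smul_add'
    zero_smul x := by
      have := add_smul' 0 0 x
      rw [add_zero] at this
      exact left_eq_add.1 this
    smul_zero z := by
      have := smul_add' z 0 0
      rw [add_zero] at this
      exact left_eq_add.1 this }

end IsStarAlgebra

theorem IsCStarAlgebra.isCStarBall (h : A.IsCStarAlgebra) (c : C) :
    let _ := h.starAlgebra.nonUnitalRing c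
    let _ := h.starAlgebra.module c
    let _ := h.starAlgebra.starRing c
    IsCStarBall (A.ballAt c) := by
  intro _ _ _
  have hs := h.seminorm
  exact
    { exists_ball a := by
        obtain ⟨q, hq⟩ := (mem_ex_iff A.N c a).1 (hs.exists_normLT c trivial)
        exact ⟨q.down, hq⟩
      rounded a q :=
        (mem_congr hs.rounded c (a, ULift.up q)).trans <| (mem_ex_iff _ c _).trans
          ⟨fun ⟨p, hp⟩ => ⟨p.down, hp⟩, fun ⟨p, hp⟩ => ⟨ULift.up p, hp⟩⟩
      zero q := mem_of_le (hs.zero (𝟙 (Const C QPos))) c (ULift.up q) trivial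
      add a b p q ha hb :=
        mem_of_le (hs.add (fst A.obj (A.obj ⊗ Const C QPos ⊗ Const C QPos)) (snd _ _ ≫ fst _ _)
          (snd _ _ ≫ snd _ _ ≫ fst _ _) (snd _ _ ≫ snd _ _ ≫ snd _ _)) c
          (a, b, ULift.up p, ULift.up q) ⟨ha, hb⟩
      mul a b p q ha hb :=
        mem_of_le (hs.mul (fst A.obj (A.obj ⊗ Const C QPos ⊗ Const C QPos)) (snd _ _ ≫ fst _ _)
          (snd _ _ ≫ snd _ _ ≫ fst _ _) (snd _ _ ≫ snd _ _ ≫ snd _ _)) c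
          (a, b, ULift.up p, ULift.up q) ⟨ha, hb⟩
      smul z a p q hz ha :=
        mem_of_le (hs.smul (fst (Const C ℂ) (A.obj ⊗ Const C QPos ⊗ Const C QPos))
          (snd _ _ ≫ fst _ _) (snd _ _ ≫ snd _ _ ≫ fst _ _) (snd _ _ ≫ snd _ _ ≫ snd _ _)) c
          (ULift.up z, a, ULift.up p, ULift.up q) ⟨hz, ha⟩
      cstar a q := mem_congr (hs.cstar (fst A.obj (Const C QPos)) (snd _ _)) c (a, ULift.up q)
      -- The internal `∀ q` ranges over all later stages; restricting the balls along `f` supplies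
      -- those instances.
      separated a ha := mem_of_le h.norm c a <| (mem_all_iff A.N c a).2 fun d f q =>
        map_mem A.N f (a, q) (ha q.down) }

/-- The arrow whose transpose is the sequence `f` in `A` at stage `c`. -/
def seqHom {c : C} (f : ℕ → A.obj.obj c) :
    Const C ℕ ⊗ coyoneda.obj (Opposite.op c) ⟶ A.obj where
  app d := ↾(fun p : ULift.{u} ℕ × (c ⟶ d) => A.obj.map p.2 (f p.1.down))
  naturality d e g := by
    ext p
    exact Functor.map_comp_apply A.obj p.2 g (f p.1.down)

/-- The sequence `f` in `A` at stage `c`, as a term of type `A ^ ℕ` in the context represented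
by `c`. -/
def seqTerm {c : C} (f : ℕ → A.obj.obj c) : coyoneda.obj (Opposite.op c) ⟶ A.Seq :=
  MonoidalClosed.curry (seqHom f)

/-- Evaluation of sequences at stage `c`. -/
def evalAt {c : C} (γ : A.Seq.obj c) (n : ℕ) : A.obj.obj c :=
  ((ihom.ev (Const C ℕ)).app A.obj).app c (ULift.up n, γ)

/-- The beta rule for the exponential. At `𝟙 c` it shows that every external sequence in `A(c)` is
the evaluation of some element of `A ^ ℕ` at `c`. -/
theorem evalAt_seqTerm {c : C} (f : ℕ → A.obj.obj c) {d : C} (g : c ⟶ d) (n : ℕ) :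
    evalAt ((seqTerm f).app d g) n = A.obj.map g (f n) :=
  app_congr (MonoidalClosed.whiskerLeft_curry_ihom_ev_app (Const C ℕ) A.obj (seqHom f)) d
    ((ULift.up n, g) : ULift.{u} ℕ × (c ⟶ d))

theorem evalAt_map {c d : C} (g : c ⟶ d) (γ : A.Seq.obj c) (n : ℕ) :
    evalAt (A.Seq.map g γ) n = A.obj.map g (evalAt γ n) :=
  NatTrans.naturality_apply ((ihom.ev (Const C ℕ)).app A.obj) g
    ((ULift.up n, γ) : ULift.{u} ℕ × A.Seq.obj c)

variable (A) in
/-- Subtraction at stage `c`. -/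
def subAt (c : C) (x y : A.obj.obj c) : A.obj.obj c := A.addAt c x (A.smulAt c (-1) y)

theorem map_subAt {c d : C} (g : c ⟶ d) (x y : A.obj.obj c) :
    A.obj.map g (A.subAt c x y) = A.subAt d (A.obj.map g x) (A.obj.map g y) := by
  have h1 := NatTrans.naturality_apply A.add g
    ((x, A.smulAt c (-1) y) : A.obj.obj c × A.obj.obj c)
  have h2 := NatTrans.naturality_apply A.smul g
    ((ULift.up (-1), y) : ULift.{u} ℂ × A.obj.obj c)
  refine h1.symm.trans ?_
  exact congrArg (A.addAt d (A.obj.map g x)) h2.symm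

theorem ballAt_map {c d : C} (g : c ⟶ d) {x : A.obj.obj c} {q : QPos} (h : A.ballAt c x q) :
    A.ballAt d (A.obj.map g x) q :=
  map_mem A.N g (x, ULift.up q) h

/-- The quantifiers over later stages collapse: identities give one direction, and restriction of
balls along `f ≫ g` gives the other. -/
theorem mem_isCauchy_iff {c : C} (γ : A.Seq.obj c) :
    γ ∈ A.isCauchy.obj c ↔ ∀ n m, A.ballAt c (A.subAt c (evalAt γ n) (evalAt γ m))
      (twoPowNeg n + twoPowNeg m) := by
  refine (mem_all_iff _ c γ).trans ⟨fun h n m => ?_, fun h d f n => ?_⟩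
  · have : A.ballAt c (A.subAt c (evalAt (A.Seq.map (𝟙 c) (A.Seq.map (𝟙 c) γ)) n)
        (evalAt (A.Seq.map (𝟙 c) (A.Seq.map (𝟙 c) γ)) m)) (twoPowNeg n + twoPowNeg m) :=
      (mem_all_iff _ c _).1 (h c (𝟙 c) (ULift.up n)) c (𝟙 c) (ULift.up m)
    rw [Functor.map_id_apply, Functor.map_id_apply] at this
    exact this
  · refine (mem_all_iff _ d _).2 fun e g m => ?_
    have := ballAt_map (f ≫ g) (h n.down m.down)
    rw [map_subAt, ← evalAt_map, ← evalAt_map, Functor.map_comp_apply] at this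
    exact this

theorem mem_hasLimit_iff {c : C} (γ : A.Seq.obj c) :
    γ ∈ A.hasLimit.obj c ↔ ∃ a, ∀ n, A.ballAt c (A.subAt c a (evalAt γ n))
      (twoPowNeg n + twoPowNeg n) := by
  refine (mem_ex_iff _ c γ).trans <| exists_congr fun a =>
    (mem_all_iff _ c _).trans ⟨fun h n => ?_, fun h d f n => ?_⟩
  · have : A.ballAt c (A.subAt c (A.obj.map (𝟙 c) a) (evalAt (A.Seq.map (𝟙 c) γ) n))
        (twoPowNeg n + twoPowNeg n) := h c (𝟙 c) (ULift.up n)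
    rw [Functor.map_id_apply, Functor.map_id_apply] at this
    exact this
  · have := ballAt_map f (h n.down)
    rw [map_subAt, ← evalAt_map] at this
    exact this

/-- The Cauchy and limit formulas see an element of `A ^ ℕ` only through its values at stage `c`,
and every sequence in `A(c)` arises as such values. -/
theorem isComplete_iff : A.IsComplete ↔ ∀ (c : C) (f : ℕ → A.obj.obj c),
    (∀ n m, A.ballAt c (A.subAt c (f n) (f m)) (twoPowNeg n + twoPowNeg m)) →
      ∃ a, ∀ n, A.ballAt c (A.subAt c a (f n)) (twoPowNeg n + twoPowNeg n) := by
  constructor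
  · intro h c f hf
    have key (n : ℕ) : evalAt ((seqTerm f).app c (𝟙 c)) n = f n := by
      rw [evalAt_seqTerm, Functor.map_id_apply]
    have := (mem_hasLimit_iff _).1 (h c ((mem_isCauchy_iff ((seqTerm f).app c (𝟙 c))).2
      (by simpa only [key] using hf)))
    simpa only [key] using this
  · intro h c γ hγ
    exact (mem_hasLimit_iff γ).2 (h c (evalAt γ) ((mem_isCauchy_iff γ).1 hγ))

end StarAlgData

/-! ### From internal C*-algebras to functors into C*-algebras -/

theorem CStar.hom_ext {A B : CStar.{u}} {f g : A ⟶ B}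
    (h : ∀ x, CStar.Hom.hom f x = CStar.Hom.hom g x) : f = g :=
  DFunLike.ext (F := A →⋆ₙₐ[ℂ] B) f g h

namespace StarAlgData

variable {C : Type u} [SmallCategory C] {A : StarAlgData C}

/-- The C*-algebra at stage `c` of a C*-algebra in `[C, Set]`. -/
abbrev IsCStarAlgebra.cstarAlgebra (h : A.IsCStarAlgebra) (c : C) :
    NonUnitalCStarAlgebra (A.obj.obj c) :=
  let _ := h.starAlgebra.nonUnitalRing c
  let _ := h.starAlgebra.module c
  let _ := h.starAlgebra.starRing c
  have : IsScalarTower ℂ (A.obj.obj c) (A.obj.obj c) :=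
    ⟨fun z x y => app_congr (h.starAlgebra.smul_mul (fst (Const C ℂ) (A.obj ⊗ A.obj))
      (snd _ _ ≫ fst _ _) (snd _ _ ≫ snd _ _)) c (ULift.up z, x, y)⟩
  have : SMulCommClass ℂ (A.obj.obj c) (A.obj.obj c) :=
    ⟨fun z x y => (app_congr (h.starAlgebra.mul_smul_comm (fst (Const C ℂ) (A.obj ⊗ A.obj))
      (snd _ _ ≫ fst _ _) (snd _ _ ≫ snd _ _)) c (ULift.up z, x, y)).symm⟩
  have : StarModule ℂ (A.obj.obj c) :=
    ⟨fun z x => app_congr (h.starAlgebra.star_smul (fst (Const C ℂ) A.obj) (snd _ _)) c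
      (ULift.up z, x)⟩
  (h.isCStarBall c).cstarAlgebra (isComplete_iff.1 h.complete c)

theorem IsCStarAlgebra.norm_lt_iff (h : A.IsCStarAlgebra) (c : C) (a : A.obj.obj c) (q : QPos) :
    (h.cstarAlgebra c).norm a < ((q : ℚ) : ℝ) ↔ A.ballAt c a q :=
  let _ := h.starAlgebra.nonUnitalRing c
  let _ := h.starAlgebra.module c
  let _ := h.starAlgebra.starRing c
  (h.isCStarBall c).gauge_lt_iff a q

/-- The functor of C*-algebras given by a C*-algebra in `[C, Set]`. -/
def IsCStarAlgebra.externalize (h : A.IsCStarAlgebra) : C ⥤ CStar.{u} where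
  obj c := @CStar.mk (A.obj.obj c) (h.cstarAlgebra c)
  map {c d} f :=
    let _ := h.cstarAlgebra c
    let _ := h.cstarAlgebra d
    { toFun := A.obj.map f
      map_smul' z x := (NatTrans.naturality_apply A.smul f
        ((ULift.up z, x) : ULift.{u} ℂ × A.obj.obj c)).symm
      map_zero' := (NatTrans.naturality_apply A.zero f PUnit.unit).symm
      map_add' x y := (NatTrans.naturality_apply A.add f
        ((x, y) : A.obj.obj c × A.obj.obj c)).symm
      map_mul' x y := (NatTrans.naturality_apply A.mul f
        ((x, y) : A.obj.obj c × A.obj.obj c)).symm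
      map_star' x := (NatTrans.naturality_apply A.star f x).symm }
  map_id c := CStar.hom_ext fun x => Functor.map_id_apply A.obj c x
  map_comp f g := CStar.hom_ext fun x => Functor.map_comp_apply A.obj f g x

theorem IsCStarAlgebra.internalizeObj_externalize (h : A.IsCStarAlgebra) :
    internalizeObj h.externalize = A := by
  have hN : (internalizeObj h.externalize).N = A.N := by
    ext c x
    exact h.norm_lt_iff c x.1 x.2.down
  -- The object and the operations agree definitionally; only the norm, rebuilt from the gauge,
  -- needs an argument.
  calc
    internalizeObj h.externalize =
        { A with N := (internalizeObj h.externalize).N } := rfl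
    _ = A := by rw [hN]

end StarAlgData

/-! ### From functors to internal C*-algebras -/

section internalizeObj

variable {C : Type u} [SmallCategory C] (F : C ⥤ CStar.{u})

theorem isStarAlgebra_internalizeObj : (internalizeObj F).IsStarAlgebra where
  add_assoc x y z := by
    ext c g
    exact add_assoc (G := F.obj c) (x.app c g) (y.app c g) (z.app c g)
  add_comm x y := by
    ext c g
    exact add_comm (G := F.obj c) (x.app c g) (y.app c g)
  zero_add x := by
    ext c g
    exact zero_add (M := F.obj c) (x.app c g)
  neg_add_cancel x := by
    ext c g
    -- Internal negation is multiplication by the scalar `-1`.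
    have key (a : F.obj c) : (-1 : ℂ) • a + a = 0 := by simp
    exact key (x.app c g)
  one_smul x := by
    ext c g
    exact one_smul (α := F.obj c) ℂ (x.app c g)
  mul_smul z w x := by
    ext c g
    exact mul_smul (β := F.obj c) (z.app c g).down (w.app c g).down (x.app c g)
  add_smul z w x := by
    ext c g
    exact add_smul (M := F.obj c) (z.app c g).down (w.app c g).down (x.app c g)
  smul_add z x y := by
    ext c g
    exact smul_add (A := F.obj c) (z.app c g).down (x.app c g) (y.app c g)
  mul_assoc x y z := by
    ext c g
    exact mul_assoc (G := F.obj c) (x.app c g) (y.app c g) (z.app c g)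
  mul_add x y z := by
    ext c g
    exact mul_add (R := F.obj c) (x.app c g) (y.app c g) (z.app c g)
  add_mul x y z := by
    ext c g
    exact add_mul (R := F.obj c) (x.app c g) (y.app c g) (z.app c g)
  smul_mul z x y := by
    ext c g
    exact smul_mul_assoc (β := F.obj c) (z.app c g).down (x.app c g) (y.app c g)
  mul_smul_comm z x y := by
    ext c g
    exact mul_smul_comm (β := F.obj c) (z.app c g).down (x.app c g) (y.app c g)
  star_star x := by
    ext c g
    exact star_star (R := F.obj c) (x.app c g)
  star_mul x y := by
    ext c g
    exact star_mul (R := F.obj c) (x.app c g) (y.app c g)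
  star_add x y := by
    ext c g
    exact star_add (R := F.obj c) (x.app c g) (y.app c g)
  star_smul z x := by
    ext c g
    exact star_smul (A := F.obj c) (z.app c g).down (x.app c g)

theorem isCStarSeminorm_internalizeObj : (internalizeObj F).IsCStarSeminorm where
  exists_normLT c a _ := by
    obtain ⟨q, hq, -⟩ := exists_qPos_btwn (norm_nonneg (E := F.obj c) a) (lt_add_one _)
    exact (mem_ex_iff _ c a).2 ⟨ULift.up q, hq⟩
  rounded := by
    ext c ⟨a, q⟩
    refine Iff.trans ?_ (mem_ex_iff _ c _).symm
    constructor
    · intro h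
      obtain ⟨p, hp, hpq⟩ := exists_qPos_btwn (norm_nonneg (E := F.obj c) a) h
      have hpq' : p < q.down := by exact_mod_cast hpq
      exact ⟨ULift.up p, hpq', hp⟩
    · rintro ⟨p, hpq, hp⟩
      have hpq' : ((p.down : ℚ) : ℝ) < ((q.down : ℚ) : ℝ) := by
        have : p.down < q.down := hpq
        exact_mod_cast this
      exact lt_trans (α := ℝ) hp hpq'
  zero q c g _ := by
    have key (q : QPos) : ‖(0 : F.obj c)‖ < ((q : ℚ) : ℝ) := by
      rw [norm_zero]
      exact_mod_cast q.2
    exact key (q.app c g).down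
  add a b p q c g h := by
    have key (a b : F.obj c) (p q : QPos) (ha : ‖a‖ < ((p : ℚ) : ℝ)) (hb : ‖b‖ < ((q : ℚ) : ℝ)) :
        ‖a + b‖ < (((p + q : QPos) : ℚ) : ℝ) := by
      push_cast
      exact (norm_add_le a b).trans_lt (add_lt_add ha hb)
    exact key (a.app c g) (b.app c g) (p.app c g).down (q.app c g).down h.1 h.2
  smul z a p q c g h := by
    have key (z : ℂ) (a : F.obj c) (p q : QPos) (hz : ‖z‖ < ((p : ℚ) : ℝ))
        (ha : ‖a‖ < ((q : ℚ) : ℝ)) : ‖z • a‖ < (((p * q : QPos) : ℚ) : ℝ) := by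
      rw [norm_smul, qPos_coe_mul]
      exact mul_lt_mul'' hz ha (norm_nonneg z) (norm_nonneg a)
    exact key (z.app c g).down (a.app c g) (p.app c g).down (q.app c g).down h.1 h.2
  mul a b p q c g h := by
    have key (a b : F.obj c) (p q : QPos) (ha : ‖a‖ < ((p : ℚ) : ℝ)) (hb : ‖b‖ < ((q : ℚ) : ℝ)) :
        ‖a * b‖ < (((p * q : QPos) : ℚ) : ℝ) := by
      rw [qPos_coe_mul]
      exact (norm_mul_le a b).trans_lt (mul_lt_mul'' ha hb (norm_nonneg a) (norm_nonneg b))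
    exact key (a.app c g) (b.app c g) (p.app c g).down (q.app c g).down h.1 h.2
  cstar a q := by
    ext c g
    have key (a : F.obj c) (q : QPos) :
        ‖a * star a‖ < (((q * q : QPos) : ℚ) : ℝ) ↔ ‖a‖ < ((q : ℚ) : ℝ) := by
      have hq : (0 : ℝ) ≤ ((q : ℚ) : ℝ) := by exact_mod_cast q.2.le
      rw [CStarRing.norm_self_mul_star, qPos_coe_mul]
      exact mul_self_lt_mul_self_iff (norm_nonneg a) hq |>.symm
    exact key (a.app c g) (q.app c g).down

theorem isNorm_internalizeObj : (internalizeObj F).IsNorm := by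
  intro c a ha
  have key (q : QPos) : (internalizeObj F).ballAt c a q := by
    have : (internalizeObj F).ballAt c ((internalizeObj F).obj.map (𝟙 c) a) q :=
      (mem_all_iff (internalizeObj F).N c a).1 ha c (𝟙 c) (ULift.up q)
    rwa [Functor.map_id_apply] at this
  have ha0 : a = (0 : F.obj c) := by
    refine norm_le_zero_iff (E := F.obj c) |>.1 (le_of_forall_gt fun x hx => ?_)
    obtain ⟨q, -, hq⟩ := exists_qPos_btwn le_rfl hx
    exact lt_trans (α := ℝ) (key q) hq
  exact ha0

/-- Letting `m` tend to infinity in the Cauchy bound gives only `‖a - f n‖ ≤ 2⁻ⁿ`; the radius `2 ·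
2⁻ⁿ` leaves room for the strict inequality. -/
theorem isComplete_internalizeObj : (internalizeObj F).IsComplete := by
  refine StarAlgData.isComplete_iff.2 fun c (f : ℕ → F.obj c) hf => ?_
  have coe_twoPowNeg_add (n m : ℕ) : (((twoPowNeg n + twoPowNeg m : QPos) : ℚ) : ℝ) =
      (1 / 2) ^ n + (1 / 2) ^ m := by
    simp [twoPowNeg]
  have hf' (n m : ℕ) : ‖f n - f m‖ < (1 / 2) ^ n + (1 / 2) ^ m := by
    have : ‖f n + (-1 : ℂ) • f m‖ < (((twoPowNeg n + twoPowNeg m : QPos) : ℚ) : ℝ) := hf n m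
    rwa [coe_twoPowNeg_add, neg_one_smul, ← sub_eq_add_neg] at this
  have lim := tendsto_pow_atTop_nhds_zero_of_lt_one (r := (1 / 2 : ℝ)) (by norm_num) (by norm_num)
  have hcauchy : CauchySeq f := by
    refine cauchySeq_of_le_tendsto_0 (fun n => (1 / 2 : ℝ) ^ n + (1 / 2) ^ n)
      (fun n m N hn hm => ?_) (by simpa using lim.add lim)
    rw [dist_eq_norm]
    exact (hf' n m).le.trans (add_le_add (pow_le_pow_of_le_one (by norm_num) (by norm_num) hn)
      (pow_le_pow_of_le_one (by norm_num) (by norm_num) hm))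
  obtain ⟨a, ha⟩ := cauchySeq_tendsto_of_complete hcauchy
  refine ⟨a, fun n => ?_⟩
  have hle : ‖a - f n‖ ≤ (1 / 2) ^ n := by
    have h1 : Filter.Tendsto (fun m => ‖f m - f n‖) Filter.atTop (nhds ‖a - f n‖) :=
      (ha.sub_const (f n)).norm
    have h2 := lim.add_const ((1 / 2 : ℝ) ^ n)
    rw [zero_add] at h2
    exact le_of_tendsto_of_tendsto' h1 h2 fun m => (hf' m n).le
  have goal : ‖a + (-1 : ℂ) • f n‖ < (((twoPowNeg n + twoPowNeg n : QPos) : ℚ) : ℝ) := by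
    rw [coe_twoPowNeg_add, neg_one_smul, ← sub_eq_add_neg]
    have : (0 : ℝ) < (1 / 2) ^ n := by positivity
    linarith
  exact goal

theorem isCStarAlgebra_internalizeObj : (internalizeObj F).IsCStarAlgebra :=
  ⟨isStarAlgebra_internalizeObj F, isCStarSeminorm_internalizeObj F, isNorm_internalizeObj F,
    isComplete_internalizeObj F⟩

/-! ### Commutativity and units -/

theorem isCommutative_internalizeObj_iff :
    (internalizeObj F).IsCommutative ↔ ∀ c : C, ∀ a b : F.obj c, a * b = b * a := by
  constructor
  · intro h c a b
    exact app_congr (h (fst (internalizeObj F).obj (internalizeObj F).obj) (snd _ _)) c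
      ((a, b) : F.obj c × F.obj c)
  · intro h Γ x y
    ext c g
    exact h c (x.app c g) (y.app c g)

theorem CStar.IsUnitElement.eq {A : CStar.{u}} {e e' : A} (h : A.IsUnitElement e)
    (h' : A.IsUnitElement e') : e = e' :=
  (h' e).2.symm.trans (h e').1

/-- The components of an internal unit are units at each stage, and its naturality is their
preservation. Conversely, uniqueness of units makes any choice of stagewise units natural. -/
theorem isUnital_internalizeObj_iff :
    (internalizeObj F).IsUnital ↔
      (∀ c : C, ∃ e : F.obj c, (F.obj c).IsUnitElement e) ∧
      ∀ (c d : C) (f : c ⟶ d) (e : F.obj c), (F.obj c).IsUnitElement e →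
        (F.obj d).IsUnitElement (CStar.Hom.hom (F.map f) e) := by
  constructor
  · rintro ⟨one, hone⟩
    have key (c : C) : (F.obj c).IsUnitElement (one.app c PUnit.unit) := fun a =>
      ⟨app_congr (hone (𝟙 _)).1 c a, app_congr (hone (𝟙 _)).2 c a⟩
    refine ⟨fun c => ⟨_, key c⟩, fun c d f e he => ?_⟩
    rw [he.eq (key c)]
    have h := key d
    have nat : CStar.Hom.hom (F.map f) (one.app c PUnit.unit) = one.app d PUnit.unit :=
      (NatTrans.naturality_apply one f PUnit.unit).symm
    rwa [← nat] at h
  · rintro ⟨hex, hmap⟩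
    choose e he using hex
    refine ⟨{ app c := ↾(fun _ => e c), naturality c d f := ?_ }, fun {Γ} x => ⟨?_, ?_⟩⟩
    · ext _
      exact (he d).eq (hmap c d f (e c) (he c))
    · ext c g
      exact (he c (x.app c g)).1
    · ext c g
      exact (he c (x.app c g)).2

end internalizeObj

/-! ### Full faithfulness -/

section internalize

variable (C : Type u) [SmallCategory C]

theorem internalize_faithful : (internalize C).Faithful where
  map_injective {F G} α β h := by
    ext c
    exact CStar.hom_ext fun x => app_congr (congrArg StarAlgData.Hom.hom h) c x

/-- The defining diagrams of an internal *-homomorphism, read at stage `c`, are the axioms of a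
*-homomorphism; no continuity has to be checked. -/
theorem internalize_full : (internalize C).Full where
  map_surjective {F G} φ := by
    refine ⟨
      { app c :=
          ({toFun := φ.hom.app c
            map_smul' z x := app_congr φ.map_smul c ((ULift.up z, x) : ULift.{u} ℂ × F.obj c)
            map_zero' := app_congr φ.map_zero c PUnit.unit
            map_add' x y := app_congr φ.map_add c ((x, y) : F.obj c × F.obj c)
            map_mul' x y := app_congr φ.map_mul c ((x, y) : F.obj c × F.obj c)
            map_star' x := app_congr φ.map_star c x } : F.obj c →⋆ₙₐ[ℂ] G.obj c)
        naturality c d f := ?_ }, rfl⟩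
    exact CStar.hom_ext fun x => NatTrans.naturality_apply φ.hom f x

end internalize
end

theorem mainTheorem8 (C : Type u) [SmallCategory C] :
    (∀ A : StarAlgData C,
      A.IsCStarAlgebra ↔ ∃ F : C ⥤ CStar.{u}, (internalize C).obj F = A) ∧
    ((internalize C).Full ∧ (internalize C).Faithful) ∧
    (∀ F : C ⥤ CStar.{u}, ((internalize C).obj F).IsCommutative ↔
      ∀ c : C, ∀ a b : F.obj c, a * b = b * a) ∧
    (∀ F : C ⥤ CStar.{u}, ((internalize C).obj F).IsUnital ↔
      (∀ c : C, ∃ e : F.obj c, (F.obj c).IsUnitElement e) ∧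
      ∀ (c d : C) (f : c ⟶ d) (e : F.obj c), (F.obj c).IsUnitElement e →
        (F.obj d).IsUnitElement (CStar.Hom.hom (F.map f) e)) :=
  ⟨fun A => ⟨fun h => ⟨h.externalize, h.internalizeObj_externalize⟩, by
      rintro ⟨F, rfl⟩
      exact isCStarAlgebra_internalizeObj F⟩,
    ⟨internalize_full C, internalize_faithful C⟩,
    fun F => isCommutative_internalizeObj_iff F, fun F => isUnital_internalizeObj_iff F⟩
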